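/- Let $k$ be a field and let $G=(V,E,w)$ be a weighted DAG: $V$ is a set, $E\subseteq V\times V$ contains no pair $(v,v)$, $w:E\to(0,\infty)$, and whenever there is a path (a sequence of at least one edge, each starting where the previous one ends) from $a$ to $b$, there is none from $b$ to $a$. The length of a path is the sum of the weights of its edges. Let $F\subseteq E$ and let $S:F\to\bigsqcup_{d\in\mathbb N}\mathrm{int}(\Delta^d)$ be a subdivision; write $S(e)=(S(e)_0,\dots,S(e)_{d(e)})$, so that $S(e)_i>0$ and $\sum_i S(e)_i=1$. The subdivided weighted digraph $s_SG$ is obtained from $G$ by replacing each edge $e=(a,b)\in F$ by a chain of edges $a=v_{e,0}\to v_{e,1}\to\dots\to v_{e,d(e)}\to v_{e,d(e)+1}=b$ through $d(e)$ new vertices, where the edge $v_{e,i}\to v_{e,i+1}$ has weight $S(e)_i\,w(e)$; the edges outside $F$ and their weights are kept. For a weighted digraph $H$ the shortest-path filtration is the family $\mathrm{SP}(H)=(\mathrm{SP}(H)_t)_{t\ge 0}$ of digraphs on the vertex set of $H$ in which $i\to j$ (for $i\ne j$) is an edge of $\mathrm{SP}(H)_t$ if and only if there is a path from $i$ to $j$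 in $H$ of length at most $t$. The directed flag complex $\mathrm{dFl}(D)$ of a digraph $D$ consists of all directed cliques of $D$ (tuples $v_0\dots v_n$ of distinct vertices with $v_i\to v_j$ whenever $i<j$), and $H(\mathrm{dFl}(D))$ is its simplicial homology with coefficients in $k$, as a graded vector space. Thus $(H\circ\mathrm{dFl})(\mathrm{SP}(H))$ is a functor from the poset $[0,\infty)$ to graded $k$-vector spaces. A $\delta$-interleaving ($\delta\geq 0$) of two such functors $M,N$ is a pair of natural families of maps $f_t:M(t)\to N(t+\delta)$, $g_t:N(t)\to M(t+\delta)$ such that $g_{t+\delta}\circ f_t=M(t\le t+2\delta)$ and $f_{t+\delta}\circ g_t=N(t\le t+2\delta)$ for all $t\ge 0$, and $d_I(M,N)\in[0,\infty]$ is the infimum of all $\delta$ for which a $\delta$-interleaving exists. Then $$d_I\big((H\circ\mathrm{dFl})(\mathrm{SP}(G)),\,(H\circ\mathrm{dFl})(\mathrm{SP}(s_SG))\big)\;\le\;\sup_{e\in F}w(e),$$ where the supremum is taken in $[0,\infty]$ (it is the maximum if $F$ is finite and non-empty, and $0$ if $F=\emptyset$). -/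

import Mathlib

open CategoryTheory
open scoped NNReal ENNReal

universe u v w

noncomputable section

namespace DirectedFlag

/-! ### Elementary paths and the regular boundary map -/

/-- An elementary `n`-path `v₀ … vₙ` is irregular if two consecutive vertices agree. -/
def Irregular {V : Type u} {n : ℕ} (p : Fin (n + 1) → V) : Prop :=
  ∃ i : Fin n, p i.castSucc = p i.succ

section Paths

variable (k : Type v) [Field k]

/-- `Λₙ`: the free vector space on all elementary `n`-paths on `V`. -/
abbrev Lam (V : Type u) (n : ℕ) : Type (max u v) := (Fin (n + 1) → V) →₀ k

/-- The path `p` as a generator of `Λₙ`. -/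
def gen {V : Type u} {n : ℕ} (p : Fin (n + 1) → V) : Lam k V n := Finsupp.single p 1

/-- The non-regular boundary `v₀ … vₙ₊₁ ↦ ∑ᵢ (-1)ⁱ v₀ … v̂ᵢ … vₙ₊₁`. -/
def nregBd (V : Type u) (n : ℕ) : Lam k V (n + 1) →ₗ[k] Lam k V n :=
  Finsupp.linearCombination k
    (fun p => ∑ i : Fin (n + 2), (-1 : k) ^ (i : ℕ) • gen k (p ∘ i.succAbove))

theorem nregBd_gen {V : Type u} {n : ℕ} (p : Fin (n + 2) → V) :
    nregBd k V n (gen k p) =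
      ∑ i : Fin (n + 2), (-1 : k) ^ (i : ℕ) • gen k (p ∘ i.succAbove) := by
  simp [nregBd, gen]

theorem lam_ext {V : Type u} {n : ℕ} {M : Type w} [AddCommGroup M] [Module k M]
    {f g : Lam k V n →ₗ[k] M} (h : ∀ p, f (gen k p) = g (gen k p)) : f = g :=
  Finsupp.lhom_ext' fun p => LinearMap.ext_ring (h p)

theorem face_face {n : ℕ} (i : Fin (n + 3)) (j : Fin (n + 2)) (i' : Fin (n + 3))
    (j' : Fin (n + 2)) (h : (i : ℕ) ≤ j) (hi : (i' : ℕ) = j + 1) (hj : (j' : ℕ) = i) :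
    i.succAbove ∘ j.succAbove = i'.succAbove ∘ j'.succAbove := by
  funext l
  ext
  simp only [Function.comp_apply, Fin.succAbove, Fin.lt_def, Fin.val_castSucc]
  split_ifs <;> simp only [Fin.val_castSucc, Fin.val_succ] at * <;> omega

theorem nregBd_nregBd (V : Type u) (n : ℕ) :
    nregBd k V n ∘ₗ nregBd k V (n + 1) = 0 := by
  apply lam_ext
  intro p
  simp only [LinearMap.comp_apply, nregBd_gen, map_sum, map_smul, LinearMap.zero_apply,
    Finset.smul_sum, smul_smul]
  rw [← Finset.sum_product']
  refine Finset.sum_involution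
    (fun (x : Fin (n + 3) × Fin (n + 2)) _ =>
      if h : (x.1 : ℕ) ≤ x.2 then
        ((x.2.succ, ⟨x.1, by omega⟩) : Fin (n + 3) × Fin (n + 2))
      else (x.2.castSucc, ⟨x.1 - 1, by omega⟩)) ?_ ?_ ?_ ?_
  · rintro ⟨i, j⟩ -
    by_cases h : (i : ℕ) ≤ j
    · rw [dif_pos h]
      dsimp only
      rw [Function.comp_assoc, Function.comp_assoc, face_face i j j.succ ⟨i, by omega⟩ h
        (by simp) rfl, ← add_smul, Fin.val_succ]
      rw [show (-1 : k) ^ (i : ℕ) * (-1) ^ (j : ℕ) + (-1) ^ ((j : ℕ) + 1) * (-1) ^ (i : ℕ) = 0 by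
        ring, zero_smul]
    · rw [dif_neg h]
      dsimp only
      rw [Function.comp_assoc, Function.comp_assoc, ← face_face j.castSucc ⟨i - 1, by omega⟩ i j
        (by simp; omega) (by simp; omega) (by simp), ← add_smul, Fin.val_castSucc]
      obtain ⟨m, hm⟩ : ∃ m, (i : ℕ) = m + 1 := ⟨i - 1, by omega⟩
      have hz : (-1 : k) ^ (i : ℕ) * (-1) ^ (j : ℕ) + (-1) ^ (j : ℕ) * (-1) ^ ((i : ℕ) - 1) = 0 := by
        rw [hm, Nat.add_sub_cancel]
        ring
      rw [hz, zero_smul]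
  · rintro ⟨i, j⟩ - - h
    by_cases h' : (i : ℕ) ≤ j
    · rw [dif_pos h'] at h
      have := congrArg (fun x => (x.1 : ℕ)) h
      simp at this
      omega
    · rw [dif_neg h'] at h
      have := congrArg (fun x => (x.1 : ℕ)) h
      simp at this
      omega
  · intros
    simp
  · rintro ⟨i, j⟩ -
    by_cases h : (i : ℕ) ≤ j
    · have h2 : ¬ (j : ℕ) + 1 ≤ i := by omega
      simp [h, h2]
    · have h2 : (j : ℕ) ≤ i - 1 := by omega
      simp only [dif_neg h, Fin.val_castSucc, h2, dite_true]
      ext <;> simp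
      omega

/-- `𝓘ₙ`: the span of the irregular paths. -/
def irr (V : Type u) (n : ℕ) : Submodule k (Lam k V n) :=
  Submodule.span k {x | ∃ p : Fin (n + 1) → V, Irregular p ∧ x = gen k p}

theorem gen_mem_irr {V : Type u} {n : ℕ} {p : Fin (n + 1) → V} (hp : Irregular p) :
    gen k p ∈ irr k V n := Submodule.subset_span ⟨p, hp, rfl⟩

theorem nregBd_irr (V : Type u) (n : ℕ) :
    irr k V (n + 1) ≤ (irr k V n).comap (nregBd k V n) := by
  rw [irr, Submodule.span_le]
  rintro _ ⟨p, ⟨i, hi⟩, rfl⟩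
  simp only [SetLike.mem_coe, Submodule.mem_comap, nregBd_gen]
  have hne : i.castSucc ≠ i.succ := (Fin.castSucc_lt_succ (i := i)).ne
  rw [← Finset.add_sum_erase _ _ (Finset.mem_univ i.castSucc),
    ← Finset.add_sum_erase _ _ (Finset.mem_erase.2 ⟨hne.symm, Finset.mem_univ i.succ⟩),
    ← add_assoc]
  refine add_mem ?_ (Submodule.sum_mem _ fun j hj => Submodule.smul_mem _ _ ?_)
  · have : p ∘ i.castSucc.succAbove = p ∘ i.succ.succAbove := by
      funext l
      rcases lt_trichotomy (l : ℕ) i with h | h | h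
      · simp only [Function.comp_apply]
        rw [Fin.succAbove_of_castSucc_lt i.castSucc l h,
          Fin.succAbove_of_castSucc_lt i.succ l (Nat.lt_succ_of_lt h)]
      · obtain rfl : l = i := Fin.ext h
        simp [hi]
      · simp only [Function.comp_apply]
        rw [Fin.succAbove_of_le_castSucc i.castSucc l h.le,
          Fin.succAbove_of_le_castSucc i.succ l h]
    rw [this, ← add_smul, Fin.val_castSucc, Fin.val_succ, pow_succ, mul_neg_one, add_neg_cancel,
      zero_smul]
    exact zero_mem _
  · simp only [Finset.mem_erase, ne_eq, Fin.ext_iff, Fin.val_succ, Fin.val_castSucc] at hj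
    apply gen_mem_irr
    rcases lt_or_gt_of_ne hj.2.1 with h | h
    · refine ⟨⟨i - 1, by omega⟩, ?_⟩
      have e1 : j.succAbove (⟨i - 1, by omega⟩ : Fin n).castSucc = i.castSucc := by
        rw [Fin.succAbove_of_le_castSucc _ _ (by simp [Fin.le_def]; omega)]
        ext
        simp
        omega
      have e2 : j.succAbove (⟨i - 1, by omega⟩ : Fin n).succ = i.succ := by
        rw [Fin.succAbove_of_le_castSucc _ _ (by simp [Fin.le_def]; omega)]
        ext
        simp
        omega
      rw [Function.comp_apply, Function.comp_apply, e1, e2, hi]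
    · have h1 : (i : ℕ) < j := by omega
      have h2 : (i : ℕ) + 1 < j := by omega
      refine ⟨⟨i, by omega⟩, ?_⟩
      have e1 : j.succAbove (⟨i, by omega⟩ : Fin n).castSucc = i.castSucc := by
        rw [Fin.succAbove_of_castSucc_lt _ _ (by rw [Fin.lt_def]; exact h1)]
        ext
        simp
      have e2 : j.succAbove (⟨i, by omega⟩ : Fin n).succ = i.succ := by
        rw [Fin.succAbove_of_castSucc_lt _ _ (by rw [Fin.lt_def]; exact h2)]
        ext
        simp
      rw [Function.comp_apply, Function.comp_apply, e1, e2, hi]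

/-- `𝓡ₙ = Λₙ / 𝓘ₙ`; the regular paths form a basis and irregular paths are zero. -/
abbrev Reg (V : Type u) (n : ℕ) : Type (max u v) := Lam k V n ⧸ irr k V n

/-- The class of the path `p` in `𝓡ₙ`. -/
def rgen {V : Type u} {n : ℕ} (p : Fin (n + 1) → V) : Reg k V n := (irr k V n).mkQ (gen k p)

/-- The regular boundary map. -/
def bd (V : Type u) (n : ℕ) : Reg k V (n + 1) →ₗ[k] Reg k V n :=
  (irr k V (n + 1)).mapQ (irr k V n) (nregBd k V n) (nregBd_irr k V n)

theorem bd_bd (V : Type u) (n : ℕ) (x : Reg k V (n + 2)) :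
    bd k V n (bd k V (n + 1) x) = 0 := by
  obtain ⟨x, rfl⟩ := Submodule.mkQ_surjective _ x
  have := LinearMap.congr_fun (nregBd_nregBd k V n) x
  simp only [LinearMap.comp_apply, LinearMap.zero_apply] at this
  simp [bd, this]

/-- The map `Λₙ(f)` sending a path `p` to `f(p)`. -/
def lamMap {V : Type u} {W : Type u} (f : V → W) (n : ℕ) : Lam k V n →ₗ[k] Lam k W n :=
  Finsupp.lmapDomain k k (fun p => f ∘ p)

theorem lamMap_gen {V W : Type u} (f : V → W) {n : ℕ} (p : Fin (n + 1) → V) :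
    lamMap k f n (gen k p) = gen k (f ∘ p) := by
  simp [lamMap, gen]

theorem lamMap_irr {V W : Type u} (f : V → W) (n : ℕ) :
    irr k V n ≤ (irr k W n).comap (lamMap k f n) := by
  rw [irr, Submodule.span_le]
  rintro _ ⟨p, ⟨i, hi⟩, rfl⟩
  simp only [SetLike.mem_coe, Submodule.mem_comap, lamMap_gen]
  exact gen_mem_irr k ⟨i, by simp [hi]⟩

/-- The map `𝓡ₙ(f)`: it sends `p` to `f(p)` if `f(p)` is regular and to `0` otherwise. -/
def regMap {V W : Type u} (f : V → W) (n : ℕ) : Reg k V n →ₗ[k] Reg k W n :=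
  (irr k V n).mapQ (irr k W n) (lamMap k f n) (lamMap_irr k f n)

theorem regMap_rgen {V W : Type u} (f : V → W) {n : ℕ} (p : Fin (n + 1) → V) :
    regMap k f n (rgen k p) = rgen k (f ∘ p) := by
  simp [regMap, rgen, lamMap_gen]

theorem rgen_irregular {V : Type u} {n : ℕ} {p : Fin (n + 1) → V} (hp : Irregular p) :
    rgen k p = 0 := by
  simpa [rgen] using gen_mem_irr k hp

theorem reg_ext {V : Type u} {n : ℕ} {M : Type w} [AddCommGroup M] [Module k M]
    {f g : Reg k V n →ₗ[k] M} (h : ∀ p, f (rgen k p) = g (rgen k p)) : f = g :=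
  Submodule.linearMap_qext _ (lam_ext k h)

theorem bd_rgen {V : Type u} {n : ℕ} (p : Fin (n + 2) → V) :
    bd k V n (rgen k p) =
      ∑ i : Fin (n + 2), (-1 : k) ^ (i : ℕ) • rgen k (p ∘ i.succAbove) := by
  rw [bd, rgen, Submodule.mkQ_apply, Submodule.mapQ_apply, ← Submodule.mkQ_apply, nregBd_gen, map_sum]
  simp [rgen]

theorem bd_regMap {V W : Type u} (f : V → W) (n : ℕ) (x : Reg k V (n + 1)) :
    bd k W n (regMap k f (n + 1) x) = regMap k f n (bd k V n x) := by
  have : bd k W n ∘ₗ regMap k f (n + 1) = regMap k f n ∘ₗ bd k V n := by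
    apply reg_ext
    intro p
    simp [regMap_rgen, bd_rgen, Function.comp_assoc]
  exact LinearMap.congr_fun this x

theorem regMap_id (V : Type u) (n : ℕ) : regMap k (id : V → V) n = LinearMap.id := by
  apply reg_ext
  intro p
  simp [regMap_rgen]

theorem regMap_comp {V W X : Type u} (f : V → W) (g : W → X) (n : ℕ) :
    regMap k (g ∘ f) n = regMap k g n ∘ₗ regMap k f n := by
  apply reg_ext
  intro p
  simp [regMap_rgen, Function.comp_assoc]

end Paths

/-! ### Regular path complexes and their chain complexes -/

/-- A regular path complex on a vertex set. -/
structure RegPathComplex where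
  /-- the vertices -/
  V : Type u
  /-- the `n`-paths that belong to the complex -/
  paths : (n : ℕ) → Set (Fin (n + 1) → V)
  singleton_mem : ∀ p : Fin 1 → V, p ∈ paths 0
  tail_mem : ∀ (n : ℕ) (p : Fin (n + 2) → V), p ∈ paths (n + 1) → p ∘ Fin.succ ∈ paths n
  init_mem : ∀ (n : ℕ) (p : Fin (n + 2) → V), p ∈ paths (n + 1) → p ∘ Fin.castSucc ∈ paths n
  regular : ∀ (n : ℕ) (p : Fin (n + 1) → V), p ∈ paths n → ¬ Irregular p

namespace RegPathComplex

/-- Weak path morphisms. -/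
@[ext]
structure Hom (P Q : RegPathComplex.{u}) where
  toFun : P.V → Q.V
  weak : ∀ (n : ℕ) (p : Fin (n + 1) → P.V), p ∈ P.paths n →
    Irregular (toFun ∘ p) ∨ toFun ∘ p ∈ Q.paths n

instance : Category RegPathComplex.{u} where
  Hom := Hom
  id P := ⟨id, fun _ _ hp => Or.inr hp⟩
  comp f g := ⟨g.toFun ∘ f.toFun, fun n p hp => by
    rcases f.weak n p hp with ⟨i, hi⟩ | h
    · exact Or.inl ⟨i, congrArg g.toFun hi⟩
    · exact g.weak n _ h⟩

variable (k : Type v) [Field k]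

/-- `Cₙ(P)`: the subspace of `𝓡ₙ` spanned by the paths in `P`. -/
def C (P : RegPathComplex.{u}) (n : ℕ) : Submodule k (Reg k P.V n) :=
  Submodule.span k {x | ∃ p ∈ P.paths n, x = rgen k p}

/-- `Ωₙ(P) = {x ∈ Cₙ(P) | ∂ₙ x ∈ Cₙ₋₁(P)}`, with `∂₀ = 0`. -/
def Omega (P : RegPathComplex.{u}) : (n : ℕ) → Submodule k (Reg k P.V n)
  | 0 => P.C k 0
  | n + 1 => P.C k (n + 1) ⊓ (P.C k n).comap (bd k P.V n)

theorem Omega_le (P : RegPathComplex.{u}) (n : ℕ) : P.Omega k n ≤ P.C k n := by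
  cases n with
  | zero => exact le_rfl
  | succ n => exact inf_le_left

theorem bd_mem_Omega (P : RegPathComplex.{u}) (n : ℕ) (x : Reg k P.V (n + 1))
    (hx : x ∈ P.Omega k (n + 1)) : bd k P.V n x ∈ P.Omega k n := by
  cases n with
  | zero => exact hx.2
  | succ n =>
    refine ⟨hx.2, ?_⟩
    change bd k P.V n (bd k P.V (n + 1) x) ∈ P.C k n
    rw [bd_bd]
    exact zero_mem _

/-- The boundary map of `Ω(P)`. -/
def OmegaBd (P : RegPathComplex.{u}) (n : ℕ) : P.Omega k (n + 1) →ₗ[k] P.Omega k n :=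
  (bd k P.V n).restrict (P.bd_mem_Omega k n)

/-- The regular chain complex `Ω(P)`. -/
def chain (P : RegPathComplex.{u}) : ChainComplex (ModuleCat.{max u v} k) ℕ :=
  ChainComplex.of (fun n => ModuleCat.of k (P.Omega k n))
    (fun n => ModuleCat.ofHom (P.OmegaBd k n)) (fun n => by
      apply ModuleCat.hom_ext
      apply LinearMap.ext
      intro x
      exact Subtype.ext (bd_bd k P.V n x.1))

theorem chain_d (P : RegPathComplex.{u}) (n : ℕ) :
    (P.chain k).d (n + 1) n = ModuleCat.ofHom (P.OmegaBd k n) :=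
  ChainComplex.of_d (fun n => ModuleCat.of k (P.Omega k n))
    (fun n => ModuleCat.ofHom (P.OmegaBd k n)) n

theorem regMap_mem_C {P Q : RegPathComplex.{u}} (f : P ⟶ Q) (n : ℕ) (x : Reg k P.V n)
    (hx : x ∈ P.C k n) : regMap k f.toFun n x ∈ Q.C k n := by
  have : P.C k n ≤ (Q.C k n).comap (regMap k f.toFun n) := by
    rw [C, Submodule.span_le]
    rintro _ ⟨p, hp, rfl⟩
    simp only [SetLike.mem_coe, Submodule.mem_comap, regMap_rgen]
    rcases f.weak n p hp with h | h
    · rw [rgen_irregular k h]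
      exact zero_mem _
    · exact Submodule.subset_span ⟨_, h, rfl⟩
  exact this hx

theorem regMap_mem_Omega {P Q : RegPathComplex.{u}} (f : P ⟶ Q) (n : ℕ) (x : Reg k P.V n)
    (hx : x ∈ P.Omega k n) : regMap k f.toFun n x ∈ Q.Omega k n := by
  cases n with
  | zero => exact regMap_mem_C k f 0 x hx
  | succ n =>
    refine ⟨regMap_mem_C k f _ x hx.1, ?_⟩
    change bd k Q.V n (regMap k f.toFun (n + 1) x) ∈ Q.C k n
    rw [bd_regMap]
    exact regMap_mem_C k f _ _ hx.2

/-- The map `Ωₙ(f)`, the restriction of `𝓡ₙ(f)`. -/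
def OmegaMap {P Q : RegPathComplex.{u}} (f : P ⟶ Q) (n : ℕ) :
    P.Omega k n →ₗ[k] Q.Omega k n :=
  (regMap k f.toFun n).restrict (regMap_mem_Omega k f n)

/-- The functor `Ω` from regular path complexes with weak path morphisms to chain complexes. -/
def chainFunctor : RegPathComplex.{u} ⥤ ChainComplex (ModuleCat.{max u v} k) ℕ where
  obj P := P.chain k
  map {P Q} f := ChainComplex.ofHom (fun n => ModuleCat.ofHom (OmegaMap k f n))
    (fun n => by
      rw [chain_d, chain_d]
      apply ModuleCat.hom_ext
      apply LinearMap.ext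
      intro x
      exact Subtype.ext (bd_regMap k f.toFun n x.1))
  map_id P := by
    ext n : 1
    apply ModuleCat.hom_ext
    apply LinearMap.ext
    intro x
    exact Subtype.ext (LinearMap.congr_fun (regMap_id k P.V n) x.1)
  map_comp {P Q R} f g := by
    ext n : 1
    apply ModuleCat.hom_ext
    apply LinearMap.ext
    intro x
    exact Subtype.ext (LinearMap.congr_fun (regMap_comp k f.toFun g.toFun n) x.1)

end RegPathComplex

/-! ### Digraphs and the directed flag complex -/

/-- Simple digraphs: no self-loops, reciprocal edges allowed. -/
structure TcDgr where
  V : Type u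
  Adj : V → V → Prop
  loopless : ∀ v, ¬ Adj v v

namespace TcDgr

/-- Triangle-collapsing digraph maps. -/
@[ext]
structure Hom (G H : TcDgr.{u}) where
  toFun : G.V → H.V
  weak : ∀ a b, G.Adj a b → toFun a = toFun b ∨ H.Adj (toFun a) (toFun b)
  collapse : ∀ a b c, G.Adj a b → G.Adj a c → G.Adj b c →
    toFun a = toFun c → toFun a = toFun b ∧ toFun b = toFun c

instance : Category TcDgr.{u} where
  Hom := Hom
  id G := ⟨id, fun _ _ h => Or.inr h, fun a b c _ hac _ (h : a = c) =>
    absurd (h ▸ hac) (G.loopless _)⟩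
  comp {G H K} f g := ⟨g.toFun ∘ f.toFun, fun a b h => by
      rcases f.weak a b h with h | h
      · exact Or.inl (congrArg g.toFun h)
      · exact g.weak _ _ h, fun a b c hab hac hbc h => by
      rcases f.weak a c hac with h1 | h1
      · obtain ⟨h2, h3⟩ := f.collapse a b c hab hac hbc h1
        exact ⟨congrArg g.toFun h2, congrArg g.toFun h3⟩
      · rcases f.weak a b hab with h2 | h2
        · exact ⟨congrArg g.toFun h2, (congrArg g.toFun h2).symm.trans h⟩
        · rcases f.weak b c hbc with h3 | h3
          · exact ⟨h.trans (congrArg g.toFun h3).symm, congrArg g.toFun h3⟩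
          · exact g.collapse _ _ _ h2 h1 h3 h⟩

/-- `v₀ … vₙ` is a directed clique: distinct vertices with `vᵢ → vⱼ` whenever `i < j`. -/
def IsClique (G : TcDgr.{u}) {n : ℕ} (p : Fin (n + 1) → G.V) : Prop :=
  Function.Injective p ∧ ∀ i j, i < j → G.Adj (p i) (p j)

/-- The directed flag complex, as a regular path complex. -/
def dFl (G : TcDgr.{u}) : RegPathComplex.{u} where
  V := G.V
  paths _ := {p | G.IsClique p}
  singleton_mem p := ⟨fun i j _ => by omega, fun i j h => by omega⟩
  tail_mem _ p hp := ⟨hp.1.comp (Fin.succ_injective _), fun i j h =>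
    hp.2 _ _ (Fin.succ_lt_succ_iff.2 h)⟩
  init_mem _ p hp := ⟨hp.1.comp (Fin.castSucc_injective _), fun i j h =>
    hp.2 _ _ (Fin.castSucc_lt_castSucc_iff.2 h)⟩
  regular _ p hp := fun ⟨i, hi⟩ => absurd (hp.1 hi) (Fin.castSucc_lt_succ (i := i)).ne

theorem weak_dFl {G H : TcDgr.{u}} (f : G ⟶ H) (n : ℕ) (p : Fin (n + 1) → G.V)
    (hp : G.IsClique p) : Irregular (f.toFun ∘ p) ∨ H.IsClique (f.toFun ∘ p) := by
  by_cases hinj : Function.Injective (f.toFun ∘ p)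
  · refine Or.inr ⟨hinj, fun i j hij => ?_⟩
    rcases f.weak _ _ (hp.2 i j hij) with h | h
    · exact absurd (hinj h) hij.ne
    · exact h
  · left
    have : ∃ i j, i < j ∧ f.toFun (p i) = f.toFun (p j) := by
      simp only [Function.Injective, not_forall] at hinj
      obtain ⟨i, j, h, hne⟩ := hinj
      rcases lt_or_gt_of_ne hne with h' | h'
      · exact ⟨i, j, h', h⟩
      · exact ⟨j, i, h', h.symm⟩
    obtain ⟨i, j, hij, h⟩ := this
    have hi : i ≠ Fin.last n := (hij.trans_le (Fin.le_last j)).ne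
    obtain ⟨i, rfl⟩ := Fin.exists_castSucc_eq.2 hi
    refine ⟨i, ?_⟩
    rcases (Fin.castSucc_lt_iff_succ_le.1 hij).eq_or_lt with h' | h'
    · rw [Function.comp_apply, Function.comp_apply, h', h]
    · exact (f.collapse _ _ _ (hp.2 _ _ Fin.castSucc_lt_succ) (hp.2 _ _ hij)
        (hp.2 _ _ h') h).1

/-- The directed flag complex as a functor. -/
def dFlFunctor : TcDgr.{u} ⥤ RegPathComplex.{u} where
  obj := dFl
  map f := ⟨f.toFun, weak_dFl f⟩

/-- Homology of the directed flag complex with coefficients in `k`, in all degrees. -/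
def homology (k : Type v) [Field k] : TcDgr.{u} ⥤ GradedObject ℕ (ModuleCat.{max u v} k) :=
  dFlFunctor ⋙ RegPathComplex.chainFunctor k ⋙ HomologicalComplex.gradedHomologyFunctor _ _

end TcDgr

/-! ### Interleavings -/

section Interleaving

variable {C : Type u} [Category.{v} C]

/-- Translation `t ↦ t + δ` of the poset `[0, ∞)`. -/
def translate (δ : ℝ≥0) : ℝ≥0 ⥤ ℝ≥0 :=
  Monotone.functor (f := fun t => t + δ) fun _ _ h => add_le_add_left h δ

/-- A `δ`-interleaving of two persistent objects indexed by `[0, ∞)`. -/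
structure Interleaving (M N : ℝ≥0 ⥤ C) (δ : ℝ≥0) where
  f : M ⟶ translate δ ⋙ N
  g : N ⟶ translate δ ⋙ M
  fg : ∀ t : ℝ≥0, f.app t ≫ g.app (t + δ) =
    M.map (homOfLE (le_self_add.trans le_self_add : t ≤ t + δ + δ))
  gf : ∀ t : ℝ≥0, g.app t ≫ f.app (t + δ) =
    N.map (homOfLE (le_self_add.trans le_self_add : t ≤ t + δ + δ))

/-- The interleaving distance, in `[0, ∞]`. -/
def interleavingDist (M N : ℝ≥0 ⥤ C) : ℝ≥0∞ :=
  ⨅ (δ : ℝ≥0) (_ : Nonempty (Interleaving M N δ)), (δ : ℝ≥0∞)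

end Interleaving

/-! ### Weighted digraphs -/

/-- A simple digraph on `V` with positive edge weights. -/
structure WeightedDigraph (V : Type u) where
  E : Set (V × V)
  loopless : ∀ v, (v, v) ∉ E
  w : E → ℝ
  w_pos : ∀ e, 0 < w e

namespace WeightedDigraph

variable {V : Type u} (G : WeightedDigraph V)

/-- Paths `a ⇝ b`: sequences of at least one edge, each starting where the previous ends. -/
inductive Path : V → V → Type u
  | single {a b : V} (h : (a, b) ∈ G.E) : Path a b
  | cons {a b c : V} (h : (a, b) ∈ G.E) (p : Path b c) : Path a c

variable {G} in
/-- The sum of the weights of the edges of a path. -/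
def Path.length : {a b : V} → G.Path a b → ℝ
  | _, _, .single h => G.w ⟨_, h⟩
  | _, _, .cons h p => G.w ⟨_, h⟩ + p.length

/-- Directed acyclic: a path `a ⇝ b` excludes a path `b ⇝ a`. -/
def IsDAG : Prop := ∀ a b, Nonempty (G.Path a b) → ¬ Nonempty (G.Path b a)

/-- The digraph at scale `t` of the shortest-path filtration. The clause `a ≠ b` keeps it simple;
it is automatic when `G` is acyclic. -/
def spAt (t : ℝ) : TcDgr.{u} where
  V := V
  Adj a b := a ≠ b ∧ ∃ p : G.Path a b, p.length ≤ t
  loopless _ h := h.1 rfl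

/-- The shortest-path filtration, with the inclusions as structure maps. -/
def SP : ℝ≥0 ⥤ TcDgr.{u} where
  obj t := G.spAt t
  map {s t} h := ⟨id,
    fun _ _ hab => Or.inr ⟨hab.1, hab.2.imp fun _ hp =>
      hp.trans (NNReal.coe_le_coe.2 (leOfHom h))⟩,
    fun _ _ _ _ hac _ h => absurd h hac.1⟩

/-- The interior of the standard `d`-simplex. -/
def OpenSimplex (d : ℕ) : Type :=
  {x : Fin (d + 1) → ℝ // (∀ i, 0 < x i) ∧ ∑ i, x i = 1}

/-- A subdivision of `G`: a map from a set `F` of edges to `⊔_d int Δ^d`. -/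
structure Subdivision where
  F : Set G.E
  S : F → Σ d : ℕ, OpenSimplex d

namespace Subdivision

variable {G} (S : G.Subdivision)

/-- The number `d(e)` of new vertices on the edge `e`. -/
def d (e : S.F) : ℕ := (S.S e).1

/-- The barycentric coordinates `S(e)₀, …, S(e)_{d(e)}`. -/
def coord (e : S.F) (i : Fin (S.d e + 1)) : ℝ := (S.S e).2.1 i

/-- The vertices of the subdivided digraph: the old ones, and `d(e)` new ones for each `e ∈ F`. -/
abbrev Vert : Type u := V ⊕ Σ e : S.F, Fin (S.d e)

/-- `v_{e,0}, …, v_{e,d(e)+1}`: the start of `e`, its new vertices in order, and its end. -/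
def vert (e : S.F) : Fin (S.d e + 2) → S.Vert :=
  Fin.cons (Sum.inl e.1.1.1) (Fin.snoc (fun i => Sum.inr ⟨e, i⟩) (Sum.inl e.1.1.2))

/-- Index type of the edges: the old edges outside `F`, and `τ_{e,0}, …, τ_{e,d(e)}` for
`e ∈ F`. -/
abbrev EdgeIdx : Type u := {e : G.E // e ∉ S.F} ⊕ Σ e : S.F, Fin (S.d e + 1)

/-- The endpoints of an edge; `τ_{e,i} = (v_{e,i}, v_{e,i+1})`. -/
def ends : S.EdgeIdx → S.Vert × S.Vert
  | .inl e => (.inl e.1.1.1, .inl e.1.1.2)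
  | .inr ⟨e, i⟩ => (S.vert e i.castSucc, S.vert e i.succ)

/-- The weight of an edge. -/
def weight : S.EdgeIdx → ℝ
  | .inl e => G.w e.1
  | .inr ⟨e, i⟩ => S.coord e i * G.w e.1

theorem vert_zero (e : S.F) : S.vert e 0 = Sum.inl e.1.1.1 := rfl

theorem vert_mid (e : S.F) (i : Fin (S.d e)) : S.vert e i.castSucc.succ = Sum.inr ⟨e, i⟩ := by
  rw [vert, Fin.cons_succ, Fin.snoc_castSucc]

theorem vert_last (e : S.F) : S.vert e (Fin.last _).succ = Sum.inl e.1.1.2 := by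
  rw [vert, Fin.cons_succ, Fin.snoc_last]

theorem vert_begin (e : S.F) (i : Fin (S.d e + 1)) :
    (i = 0 ∧ S.vert e i.castSucc = Sum.inl e.1.1.1) ∨
      ∃ j : Fin (S.d e), i = j.succ ∧ S.vert e i.castSucc = Sum.inr ⟨e, j⟩ := by
  rcases Fin.eq_zero_or_eq_succ i with rfl | ⟨j, rfl⟩
  · exact Or.inl ⟨rfl, rfl⟩
  · exact Or.inr ⟨j, rfl, by rw [← Fin.succ_castSucc, vert_mid]⟩

theorem vert_finish (e : S.F) (i : Fin (S.d e + 1)) :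
    (i = Fin.last _ ∧ S.vert e i.succ = Sum.inl e.1.1.2) ∨
      ∃ j : Fin (S.d e), i = j.castSucc ∧ S.vert e i.succ = Sum.inr ⟨e, j⟩ := by
  rcases Fin.eq_castSucc_or_eq_last i with ⟨j, rfl⟩ | rfl
  · exact Or.inr ⟨j, rfl, S.vert_mid e j⟩
  · exact Or.inl ⟨rfl, S.vert_last e⟩

theorem ends_injective : Function.Injective S.ends := by
  rintro (e | ⟨e, i⟩) (e' | ⟨e', i'⟩) h
  · obtain ⟨h1, h2⟩ := Prod.mk.inj h
    exact congrArg Sum.inl (Subtype.ext (Subtype.ext (Prod.ext (Sum.inl.inj h1) (Sum.inl.inj h2))))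
  · exfalso
    obtain ⟨h1, h2⟩ := Prod.mk.inj h
    rcases S.vert_begin e' i' with ⟨-, h3⟩ | ⟨j, -, h3⟩ <;> rw [h3] at h1
    · rcases S.vert_finish e' i' with ⟨-, h4⟩ | ⟨j, -, h4⟩ <;> rw [h4] at h2
      · exact e.2 ((Subtype.ext (Prod.ext (Sum.inl.inj h1) (Sum.inl.inj h2)) : e.1 = e'.1) ▸ e'.2)
      · cases h2
    · cases h1
  · exfalso
    obtain ⟨h1, h2⟩ := Prod.mk.inj h
    rcases S.vert_begin e i with ⟨-, h3⟩ | ⟨j, -, h3⟩ <;> rw [h3] at h1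
    · rcases S.vert_finish e i with ⟨-, h4⟩ | ⟨j, -, h4⟩ <;> rw [h4] at h2
      · exact e'.2 ((Subtype.ext (Prod.ext (Sum.inl.inj h1) (Sum.inl.inj h2)) : e.1 = e'.1) ▸ e.2)
      · cases h2
    · cases h1
  · obtain ⟨h1, h2⟩ := Prod.mk.inj h
    rcases S.vert_begin e i with ⟨hi, h3⟩ | ⟨j, hi, h3⟩ <;>
      rcases S.vert_begin e' i' with ⟨hi', h3'⟩ | ⟨j', hi', h3'⟩ <;> rw [h3, h3'] at h1
    · rcases S.vert_finish e i with ⟨-, h4⟩ | ⟨j, hj, h4⟩ <;>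
        rcases S.vert_finish e' i' with ⟨-, h4'⟩ | ⟨j', hj', h4'⟩ <;> rw [h4, h4'] at h2
      · obtain rfl : e = e' :=
          Subtype.ext (Subtype.ext (Prod.ext (Sum.inl.inj h1) (Sum.inl.inj h2)))
        rw [hi, hi']
      · cases h2
      · cases h2
      · have h5 := Sum.inr.inj h2
        obtain rfl : e = e' := congrArg Sigma.fst h5
        rw [hi, hi']
    · cases h1
    · cases h1
    · have h5 := Sum.inr.inj h1
      obtain rfl : e = e' := congrArg Sigma.fst h5
      obtain rfl : j = j' := eq_of_heq (Sigma.mk.inj h5).2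
      rw [hi, hi']

theorem ends_ne (x : S.EdgeIdx) : (S.ends x).1 ≠ (S.ends x).2 := by
  rcases x with e | ⟨e, i⟩
  · intro h
    have h' : e.1.1.1 = e.1.1.2 := Sum.inl.inj h
    exact G.loopless e.1.1.1 ((Prod.ext rfl h' : (e.1.1.1, e.1.1.1) = e.1.1) ▸ e.1.2)
  · intro h
    change S.vert e i.castSucc = S.vert e i.succ at h
    rcases S.vert_begin e i with ⟨-, h3⟩ | ⟨j, hi, h3⟩ <;>
      rcases S.vert_finish e i with ⟨-, h4⟩ | ⟨j', hj, h4⟩ <;> rw [h3, h4] at h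
    · have h' : e.1.1.1 = e.1.1.2 := Sum.inl.inj h
      exact G.loopless e.1.1.1 ((Prod.ext rfl h' : (e.1.1.1, e.1.1.1) = e.1.1) ▸ e.1.2)
    · cases h
    · cases h
    · obtain rfl : j = j' := eq_of_heq (Sigma.mk.inj (Sum.inr.inj h)).2
      have := congrArg Fin.val (hi.symm.trans hj)
      simp at this

/-- The subdivided weighted digraph. -/
def subdivide : WeightedDigraph S.Vert where
  E := Set.range S.ends
  loopless v := fun ⟨x, hx⟩ => S.ends_ne x (by rw [hx])
  w e := S.weight ((Equiv.ofInjective S.ends S.ends_injective).symm e)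
  w_pos e := by
    rcases (Equiv.ofInjective S.ends S.ends_injective).symm e with e | ⟨e, i⟩
    · exact G.w_pos _
    · exact mul_pos ((S.S e).2.2.1 i) (G.w_pos _)

end Subdivision

end WeightedDigraph

end DirectedFlag

end

/-! Let r be the map on vertices of the subdivision that fixes the old vertices and sends each new
vertex to the start of its edge, and let ι be the inclusion of the old vertices. Every edge of `F`
is replaced by a chain of the same total length, so ι preserves path lengths. The offset of a vertex
x is the distance from r(x) to x along its chain; it lies between 0 and w(e). A path from x to y of
length L becomes, under r, either a constant or a path of length L + offset x - offset y
(`Subdivision.tracks_path`). So r costs at most δ = sup w(e), and ι and r are morphisms of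
filtrations with shift δ.

The composite r ∘ ι is the identity on the nose. The composite ι ∘ r is not, but r(x) reaches x, and
also every y with x → y, within an extra δ. This makes ι ∘ r one-step homotopic to the structure map
(`Subdivision.stepHomotopic_retraction_inclusion`). On directed flag complexes such a homotopy gives
a chain homotopy through the prism operator (`nregBd_lamPrism`): its paths φp₀…φpᵢψpᵢ…ψpₙ are
cliques or irregular, because a subdivision of a DAG is again a DAG. Hence both triangle identities
hold in homology. -/

noncomputable section

namespace DirectedFlag

/-! ### The prism operator on elementary paths. -/

section Prism

variable {V W : Type u}

/-- The path `φ p₀ … φ pᵢ ψ pᵢ … ψ pₙ`. -/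
def prismPath (φ ψ : V → W) {n : ℕ} (i : Fin (n + 1)) (p : Fin (n + 1) → V) : Fin (n + 2) → W :=
  fun j => if j ≤ i.castSucc then φ (p (i.predAbove j)) else ψ (p (i.predAbove j))

theorem prismPath_zero (φ ψ : V → W) {n : ℕ} (p : Fin (n + 1) → V) :
    prismPath φ ψ 0 p = Fin.cons (φ (p 0)) (ψ ∘ p) := by
  funext j
  refine Fin.cases ?_ (fun j => ?_) j
  · simp [prismPath]
  · simp [prismPath]

theorem prismPath_succ (φ ψ : V → W) {n : ℕ} (i : Fin (n + 1)) (p : Fin (n + 2) → V) :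
    prismPath φ ψ i.succ p = Fin.cons (φ (p 0)) (prismPath φ ψ i (Fin.tail p)) := by
  funext j
  refine Fin.cases ?_ (fun j => ?_) j
  · simp [prismPath]
  · simp [prismPath, Fin.le_def, Fin.tail, Fin.succ_predAbove_succ]

/-- A repetition in `p` before position `i` survives in the φ-part, any other in the ψ-part. So each
prism is irregular by itself, without cancellation, and the operator descends to regular paths. -/
theorem Irregular.prismPath {φ ψ : V → W} {n : ℕ} {p : Fin (n + 1) → V} (hp : Irregular p)
    (i : Fin (n + 1)) : Irregular (prismPath φ ψ i p) := by
  obtain ⟨l, hl⟩ := hp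
  by_cases h : (l : ℕ) < i
  · refine ⟨l.castSucc, ?_⟩
    have h1 : l.castSucc.castSucc ≤ i.castSucc := by simp [Fin.le_def]; omega
    have h2 : l.castSucc.succ ≤ i.castSucc := by simp [Fin.le_def]; omega
    have e1 : i.predAbove l.castSucc.castSucc = l.castSucc := by
      rw [Fin.predAbove_of_le_castSucc _ _ h1]; ext; simp
    have e2 : i.predAbove l.castSucc.succ = l.succ := by
      rw [Fin.predAbove_of_le_castSucc _ _ h2]; ext; simp
    rw [DirectedFlag.prismPath, DirectedFlag.prismPath, if_pos h1, if_pos h2, e1, e2, hl]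
  · refine ⟨l.succ, ?_⟩
    have h1 : i.castSucc < l.succ.castSucc := by simp [Fin.lt_def]; omega
    have h2 : i.castSucc < l.succ.succ := by simp [Fin.lt_def]; omega
    have e1 : i.predAbove l.succ.castSucc = l.castSucc := by
      rw [Fin.predAbove_of_castSucc_lt _ _ h1]; ext; simp
    have e2 : i.predAbove l.succ.succ = l.succ := by
      rw [Fin.predAbove_of_castSucc_lt _ _ h2]; ext; simp
    rw [DirectedFlag.prismPath, DirectedFlag.prismPath, if_neg h1.not_ge, if_neg h2.not_ge,
      e1, e2, hl]

variable (k : Type v) [Field k]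

/-- Prepending the vertex `a` to every path. -/
def lamCons (a : V) (n : ℕ) : Lam k V n →ₗ[k] Lam k V (n + 1) :=
  Finsupp.lmapDomain k k (fun p => Fin.cons a p)

theorem lamCons_gen (a : V) {n : ℕ} (p : Fin (n + 1) → V) :
    lamCons k a n (gen k p) = gen k (Fin.cons a p : Fin (n + 2) → V) := by
  simp [lamCons, gen]

theorem cons_comp_succ_succAbove (a : V) {n : ℕ} (p : Fin (n + 2) → V) (i : Fin (n + 2)) :
    (Fin.cons a p : Fin (n + 3) → V) ∘ i.succ.succAbove = Fin.cons a (p ∘ i.succAbove) := by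
  funext j
  refine Fin.cases ?_ (fun j => ?_) j <;> simp

theorem cons_comp_zero_succAbove (a : V) {n : ℕ} (p : Fin (n + 1) → V) :
    (Fin.cons a p : Fin (n + 2) → V) ∘ (0 : Fin (n + 2)).succAbove = p := by
  funext j
  simp

/-- The cone formula: deleting `a` returns `x`, and deleting any other vertex shifts its index by
one, hence the sign. -/
theorem nregBd_lamCons (a : V) {n : ℕ} (x : Lam k V (n + 1)) :
    nregBd k V (n + 1) (lamCons k a (n + 1) x) = x - lamCons k a n (nregBd k V n x) := by
  have : nregBd k V (n + 1) ∘ₗ lamCons k a (n + 1) =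
      LinearMap.id - lamCons k a n ∘ₗ nregBd k V n := by
    apply lam_ext
    intro p
    simp only [LinearMap.comp_apply, LinearMap.sub_apply, LinearMap.id_apply, lamCons_gen,
      nregBd_gen, map_sum, map_smul]
    rw [Fin.sum_univ_succ, cons_comp_zero_succAbove, sub_eq_add_neg, ← Finset.sum_neg_distrib]
    simp only [cons_comp_succ_succAbove, Fin.val_succ, Fin.val_zero, pow_succ, pow_zero, one_smul,
      mul_neg_one, neg_smul]
  exact LinearMap.congr_fun this x

/-- The prism operator of a pair of maps of vertex sets. -/
def lamPrism (φ ψ : V → W) (n : ℕ) : Lam k V n →ₗ[k] Lam k W (n + 1) :=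
  Finsupp.linearCombination k
    (fun p => ∑ i : Fin (n + 1), (-1 : k) ^ (i : ℕ) • gen k (prismPath φ ψ i p))

theorem lamPrism_gen (φ ψ : V → W) {n : ℕ} (p : Fin (n + 1) → V) :
    lamPrism k φ ψ n (gen k p) =
      ∑ i : Fin (n + 1), (-1 : k) ^ (i : ℕ) • gen k (prismPath φ ψ i p) := by
  simp [lamPrism, gen]

theorem lamMap_lamCons (ψ : V → W) (a : V) {n : ℕ} (x : Lam k V n) :
    lamMap k ψ (n + 1) (lamCons k a n x) = lamCons k (ψ a) n (lamMap k ψ n x) := by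
  have : lamMap k ψ (n + 1) ∘ₗ lamCons k a n = lamCons k (ψ a) n ∘ₗ lamMap k ψ n := by
    apply lam_ext
    intro p
    simp only [LinearMap.comp_apply, lamCons_gen, lamMap_gen]
    congr 1
    funext j
    refine Fin.cases ?_ (fun j => ?_) j <;> simp
  exact LinearMap.congr_fun this x

theorem nregBd_lamMap (ψ : V → W) {n : ℕ} (x : Lam k V (n + 1)) :
    nregBd k W n (lamMap k ψ (n + 1) x) = lamMap k ψ n (nregBd k V n x) := by
  have : nregBd k W n ∘ₗ lamMap k ψ (n + 1) = lamMap k ψ n ∘ₗ nregBd k V n := by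
    apply lam_ext
    intro p
    simp [lamMap_gen, nregBd_gen, Function.comp_assoc]
  exact LinearMap.congr_fun this x

/-- The sum splits according to whether the doubled vertex is `a` or a later one. This recursion
lets the homotopy identity be proved by induction instead of by manipulating double sums. -/
theorem lamPrism_lamCons (φ ψ : V → W) (a : V) {n : ℕ} (x : Lam k V n) :
    lamPrism k φ ψ (n + 1) (lamCons k a n x) =
      lamCons k (φ a) (n + 1) (lamCons k (ψ a) n (lamMap k ψ n x)) -
        lamCons k (φ a) (n + 1) (lamPrism k φ ψ n x) := by
  have : lamPrism k φ ψ (n + 1) ∘ₗ lamCons k a n =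
      lamCons k (φ a) (n + 1) ∘ₗ lamMap k ψ (n + 1) ∘ₗ lamCons k a n -
        lamCons k (φ a) (n + 1) ∘ₗ lamPrism k φ ψ n := by
    apply lam_ext
    intro p
    simp only [LinearMap.comp_apply, LinearMap.sub_apply, lamCons_gen, lamPrism_gen, lamMap_gen]
    rw [Fin.sum_univ_succ, prismPath_zero, map_sum, sub_eq_add_neg, ← Finset.sum_neg_distrib]
    simp [prismPath_succ, pow_succ, lamCons_gen]
  have h := LinearMap.congr_fun this x
  simpa only [LinearMap.comp_apply, LinearMap.sub_apply, lamMap_lamCons] using h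

/-- The cone formula in lowest degree, where the complex is not augmented and deleting `q` leaves
the vertex `a`. -/
theorem nregBd_gen_cons (a : V) (q : Fin 1 → V) :
    nregBd k V 0 (gen k (Fin.cons a q : Fin 2 → V)) = gen k q - gen k (fun _ => a) := by
  have h : (Fin.cons a q : Fin 2 → V) ∘ (1 : Fin 2).succAbove = fun _ => a := by
    funext j
    fin_cases j
    simp
  rw [nregBd_gen, Fin.sum_univ_two, cons_comp_zero_succAbove, h]
  simp [sub_eq_add_neg]

theorem lamPrism_gen_zero (φ ψ : V → W) (p : Fin 1 → V) :
    lamPrism k φ ψ 0 (gen k p) = gen k (Fin.cons (φ (p 0)) (ψ ∘ p) : Fin 2 → W) := by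
  rw [lamPrism_gen, Fin.sum_univ_succ, prismPath_zero]
  simp

theorem nregBd_lamPrism_zero (φ ψ : V → W) (x : Lam k V 0) :
    nregBd k W 0 (lamPrism k φ ψ 0 x) = lamMap k ψ 0 x - lamMap k φ 0 x := by
  have : nregBd k W 0 ∘ₗ lamPrism k φ ψ 0 = lamMap k ψ 0 - lamMap k φ 0 := by
    apply lam_ext
    intro p
    have h : φ ∘ p = fun _ => φ (p 0) := by
      funext j
      fin_cases j
      rfl
    rw [LinearMap.comp_apply, LinearMap.sub_apply, lamPrism_gen_zero, nregBd_gen_cons,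
      lamMap_gen, lamMap_gen, h]
  exact LinearMap.congr_fun this x

theorem nregBd_lamPrism_gen_one (φ ψ : V → W) (p : Fin 2 → V) :
    nregBd k W 1 (lamPrism k φ ψ 1 (gen k p)) + lamPrism k φ ψ 0 (nregBd k V 0 (gen k p)) =
      lamMap k ψ 1 (gen k p) - lamMap k φ 1 (gen k p) := by
  obtain ⟨a, q, rfl⟩ : ∃ a q, p = Fin.cons a q := ⟨p 0, Fin.tail p, (Fin.cons_self_tail p).symm⟩
  have h : lamPrism k φ ψ 0 (gen k fun _ => a) = lamCons k (φ a) 0 (gen k fun _ => ψ a) := by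
    rw [lamPrism_gen_zero, lamCons_gen]
    rfl
  rw [nregBd_gen_cons, ← lamCons_gen, lamPrism_lamCons, map_sub, map_sub, nregBd_lamCons,
    nregBd_lamCons, nregBd_lamPrism_zero, h, lamMap_lamCons, lamMap_lamCons, lamMap_gen,
    lamMap_gen, lamCons_gen, nregBd_gen_cons]
  simp only [map_sub, lamCons_gen]
  abel

/-- Induction on the degree, splitting off the first vertex `a` of a path `aq`. By the cone formula
and the prism recursion, the left side becomes ψ(aq) - φ(a)ψ(q) + φ(a)(∂Pq + P∂q), and the induction
hypothesis turns the last bracket into ψ(q) - φ(q). -/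
theorem nregBd_lamPrism (φ ψ : V → W) (n : ℕ) (x : Lam k V (n + 1)) :
    nregBd k W (n + 1) (lamPrism k φ ψ (n + 1) x) + lamPrism k φ ψ n (nregBd k V n x) =
      lamMap k ψ (n + 1) x - lamMap k φ (n + 1) x := by
  have : nregBd k W (n + 1) ∘ₗ lamPrism k φ ψ (n + 1) + lamPrism k φ ψ n ∘ₗ nregBd k V n =
      lamMap k ψ (n + 1) - lamMap k φ (n + 1) := by
    clear x
    induction n with
    | zero => exact lam_ext k fun p => nregBd_lamPrism_gen_one k φ ψ p
    | succ n ih =>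
      apply lam_ext
      intro p
      obtain ⟨a, q, rfl⟩ : ∃ a q, p = Fin.cons a q := ⟨p 0, Fin.tail p, (Fin.cons_self_tail p).symm⟩
      have h := LinearMap.congr_fun ih (gen k q)
      simp only [LinearMap.comp_apply, LinearMap.sub_apply, LinearMap.add_apply] at h ⊢
      rw [← lamCons_gen, nregBd_lamCons, lamPrism_lamCons]
      simp only [map_sub, nregBd_lamCons, lamPrism_lamCons, lamMap_lamCons, nregBd_lamMap]
      rw [← eq_sub_iff_add_eq] at h
      rw [h]
      simp only [map_sub]
      abel
  exact LinearMap.congr_fun this x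

theorem lamPrism_irr (φ ψ : V → W) (n : ℕ) :
    irr k V n ≤ (irr k W (n + 1)).comap (lamPrism k φ ψ n) := by
  rw [irr, Submodule.span_le]
  rintro _ ⟨p, hp, rfl⟩
  simp only [SetLike.mem_coe, Submodule.mem_comap, lamPrism_gen]
  exact Submodule.sum_mem _ fun i _ => Submodule.smul_mem _ _ (gen_mem_irr k (hp.prismPath i))

/-- The prism operator on regular paths. -/
def regPrism (φ ψ : V → W) (n : ℕ) : Reg k V n →ₗ[k] Reg k W (n + 1) :=
  (irr k V n).mapQ (irr k W (n + 1)) (lamPrism k φ ψ n) (lamPrism_irr k φ ψ n)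

theorem regPrism_rgen (φ ψ : V → W) {n : ℕ} (p : Fin (n + 1) → V) :
    regPrism k φ ψ n (rgen k p) =
      ∑ i : Fin (n + 1), (-1 : k) ^ (i : ℕ) • rgen k (prismPath φ ψ i p) := by
  rw [regPrism, rgen, Submodule.mkQ_apply, Submodule.mapQ_apply, ← Submodule.mkQ_apply,
    lamPrism_gen, map_sum]
  simp [rgen]

theorem bd_regPrism_zero (φ ψ : V → W) (x : Reg k V 0) :
    bd k W 0 (regPrism k φ ψ 0 x) = regMap k ψ 0 x - regMap k φ 0 x := by
  obtain ⟨x, rfl⟩ := Submodule.mkQ_surjective _ x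
  exact congrArg (irr k W 0).mkQ (nregBd_lamPrism_zero k φ ψ x)

theorem bd_regPrism (φ ψ : V → W) (n : ℕ) (x : Reg k V (n + 1)) :
    bd k W (n + 1) (regPrism k φ ψ (n + 1) x) + regPrism k φ ψ n (bd k V n x) =
      regMap k ψ (n + 1) x - regMap k φ (n + 1) x := by
  obtain ⟨x, rfl⟩ := Submodule.mkQ_surjective _ x
  exact congrArg (irr k W (n + 1)).mkQ (nregBd_lamPrism k φ ψ n x)

end Prism

end DirectedFlag

end

noncomputable section
namespace DirectedFlag

/-! ### Chain homotopies from prisms. -/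

namespace RegPathComplex

variable {P Q : RegPathComplex.{u}}

/-- The prisms from `f` to `g` over the paths of `P` are regular paths of `Q` or irregular. -/
def PrismCompatible (f g : P ⟶ Q) : Prop :=
  ∀ (n : ℕ) (p : Fin (n + 1) → P.V), p ∈ P.paths n → ∀ i : Fin (n + 1),
    Irregular (prismPath f.toFun g.toFun i p) ∨ prismPath f.toFun g.toFun i p ∈ Q.paths (n + 1)

namespace PrismCompatible

variable {f g : P ⟶ Q} (k : Type v) [Field k]

theorem regPrism_mem_C (hfg : PrismCompatible f g) {n : ℕ} {x : Reg k P.V n} (hx : x ∈ P.C k n) :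
    regPrism k f.toFun g.toFun n x ∈ Q.C k (n + 1) := by
  have : P.C k n ≤ (Q.C k (n + 1)).comap (regPrism k f.toFun g.toFun n) := by
    rw [C, Submodule.span_le]
    rintro _ ⟨p, hp, rfl⟩
    rw [SetLike.mem_coe, Submodule.mem_comap, regPrism_rgen]
    refine Submodule.sum_mem _ fun i _ => Submodule.smul_mem _ _ ?_
    rcases hfg n p hp i with h | h
    · rw [rgen_irregular k h]
      exact zero_mem _
    · exact Submodule.subset_span ⟨_, h, rfl⟩
  exact this hx

/-- The homotopy identity expresses ∂Px through g(x), f(x) and P∂x. All three lie in `Q.C`, since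
both `x` and ∂x lie in `P.C`. -/
theorem regPrism_mem_Omega (hfg : PrismCompatible f g) (n : ℕ) (x : Reg k P.V n) (hx : x ∈ P.Omega k n) :
    regPrism k f.toFun g.toFun n x ∈ Q.Omega k (n + 1) := by
  have hC := P.Omega_le k n hx
  refine ⟨hfg.regPrism_mem_C k hC, ?_⟩
  have hf := regMap_mem_C k f n x hC
  have hg := regMap_mem_C k g n x hC
  rw [SetLike.mem_coe, Submodule.mem_comap]
  cases n with
  | zero =>
    rw [bd_regPrism_zero]
    exact sub_mem hg hf
  | succ n =>
    rw [eq_sub_of_add_eq (bd_regPrism k f.toFun g.toFun n x)]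
    exact sub_mem (sub_mem hg hf) (hfg.regPrism_mem_C k hx.2)

/-- The restriction of the prism operator to `Ωₙ`. -/
def omegaPrism (hfg : PrismCompatible f g) (n : ℕ) : P.Omega k n →ₗ[k] Q.Omega k (n + 1) :=
  (regPrism k f.toFun g.toFun n).restrict (hfg.regPrism_mem_Omega k n)

/-- The components of the chain homotopy given by the prism operator. -/
def chainPrism (hfg : PrismCompatible f g) (i j : ℕ) (h : (ComplexShape.down ℕ).Rel j i) :
    (P.chain k).X i ⟶ (Q.chain k).X j :=
  ModuleCat.ofHom (hfg.omegaPrism k i) ≫ eqToHom (congrArg (Q.chain k).X h)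

theorem sub_eq_nullHomotopicMap (hfg : PrismCompatible f g) :
    (chainFunctor k).map g - (chainFunctor k).map f =
      Homotopy.nullHomotopicMap' (hfg.chainPrism k) := by
  ext n : 1
  cases n with
  | zero =>
    -- No differential leaves degree 0, so only the term ∂P is present.
    rw [Homotopy.nullHomotopicMap'_f_of_not_rel_left (k₁ := 1) (k₀ := 0) rfl (by simp)]
    rw [show (Q.chain k).d 1 0 = _ from chain_d k Q 0]
    apply ModuleCat.hom_ext
    apply LinearMap.ext
    intro x
    exact Subtype.ext (bd_regPrism_zero k f.toFun g.toFun x.1).symm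
  | succ n =>
    rw [Homotopy.nullHomotopicMap'_f (k₂ := n + 2) (k₁ := n + 1) (k₀ := n) rfl rfl]
    rw [chain_d k P n, show (Q.chain k).d (n + 2) (n + 1) = _ from chain_d k Q (n + 1)]
    apply ModuleCat.hom_ext
    apply LinearMap.ext
    intro x
    exact Subtype.ext ((bd_regPrism k f.toFun g.toFun n x.1).symm.trans (add_comm _ _))

/-- The chain homotopy given by the prism operator. -/
def homotopy (hfg : PrismCompatible f g) :
    Homotopy ((chainFunctor k).map g) ((chainFunctor k).map f) :=
  Homotopy.equivSubZero.symm
    ((Homotopy.ofEq (hfg.sub_eq_nullHomotopicMap k)).trans (Homotopy.nullHomotopy' _))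

end PrismCompatible

end RegPathComplex

/-! ### One-step homotopies of digraph maps. -/

namespace TcDgr

variable {P Q : TcDgr.{u}}

/-- If qᵢ = qⱼ with i < j but qᵢ ≠ qᵢ₊₁, then there are edges qᵢ → qᵢ₊₁ and qᵢ₊₁ → qⱼ = qᵢ,
contradicting asymmetry. So a sequence without consecutive repetitions has none at all. -/
theorem irregular_or_isClique (hQ : ∀ a b, Q.Adj a b → ¬ Q.Adj b a) {n : ℕ}
    (q : Fin (n + 1) → Q.V) (hq : ∀ i j, i < j → q i = q j ∨ Q.Adj (q i) (q j)) :
    Irregular q ∨ Q.IsClique q := by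
  by_cases hirr : Irregular q
  · exact Or.inl hirr
  have hne : ∀ i j, i < j → q i ≠ q j := by
    intro i j hij h
    obtain ⟨i, rfl⟩ := Fin.exists_castSucc_eq.2 (hij.trans_le (Fin.le_last j)).ne
    have h1 : q i.castSucc ≠ q i.succ := fun h => hirr ⟨i, h⟩
    rcases (Fin.castSucc_lt_iff_succ_le.1 hij).eq_or_lt with h' | h'
    · exact h1 (h.trans (congrArg q h').symm)
    · have h2 := (hq _ _ (Fin.castSucc_lt_succ (i := i))).resolve_left h1
      have h3 := (hq _ _ h').resolve_left fun h4 => h1 (h.trans h4.symm)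
      exact hQ _ _ h2 (h ▸ h3)
  refine Or.inr ⟨fun i j h => ?_, fun i j hij => (hq i j hij).resolve_left (hne i j hij)⟩
  by_contra hij
  rcases lt_or_gt_of_ne hij with h' | h'
  · exact hne _ _ h' h
  · exact hne _ _ h' h.symm

/-- A one-step homotopy `f ⇒ g`: `f x` equals `g y` or has an edge to it whenever `x = y` or
`x → y`. -/
def StepHomotopic (f g : P ⟶ Q) : Prop :=
  (∀ x, f.toFun x = g.toFun x ∨ Q.Adj (f.toFun x) (g.toFun x)) ∧
    ∀ x y, P.Adj x y → f.toFun x = g.toFun y ∨ Q.Adj (f.toFun x) (g.toFun y)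

variable {f g : P ⟶ Q}

theorem StepHomotopic.prismCompatible (hfg : StepHomotopic f g)
    (hQ : ∀ a b, Q.Adj a b → ¬ Q.Adj b a) :
    RegPathComplex.PrismCompatible (dFlFunctor.map f) (dFlFunctor.map g) := by
  intro n p hp i
  refine irregular_or_isClique hQ (prismPath f.toFun g.toFun i p) ?_
  intro a b hab
  -- `i.predAbove` gives the index in `p` underlying a position of the prism. Two distinct positions
  -- share an index only at the doubled vertex.
  have hle : i.predAbove a ≤ i.predAbove b := Fin.predAbove_right_monotone i hab.le
  unfold prismPath
  rcases hle.eq_or_lt with h | h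
  · rw [h]
    split_ifs with h1 h2 h2
    · exact Or.inl rfl
    · exact hfg.1 _
    · exact absurd (hab.le.trans h2) h1
    · exact Or.inl rfl
  · have hadj := hp.2 _ _ h
    split_ifs with h1 h2 h2
    · exact f.weak _ _ hadj
    · exact hfg.2 _ _ hadj
    · exact absurd (hab.le.trans h2) h1
    · exact g.weak _ _ hadj

theorem StepHomotopic.homology_map_eq (hfg : StepHomotopic f g)
    (hQ : ∀ a b, Q.Adj a b → ¬ Q.Adj b a) (k : Type v) [Field k] :
    (homology k).map f = (homology k).map g := by
  funext n
  exact (((hfg.prismCompatible hQ).homotopy k).homologyMap_eq n).symm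

end TcDgr

end DirectedFlag

end

noncomputable section
namespace DirectedFlag

/-! ### Path lengths and acyclicity. -/

namespace WeightedDigraph

variable {V : Type u} {G : WeightedDigraph V}

/-- Concatenation of paths. -/
def Path.append : {a b c : V} → G.Path a b → G.Path b c → G.Path a c
  | _, _, _, .single h, q => .cons h q
  | _, _, _, .cons h p, q => .cons h (p.append q)

theorem Path.length_append {a b c : V} (p : G.Path a b) (q : G.Path b c) :
    (p.append q).length = p.length + q.length := by
  induction p with
  | single h => rfl
  | cons h p ih => simp only [append, length, ih, add_assoc]

theorem Path.length_pos {a b : V} (p : G.Path a b) : 0 < p.length := by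
  induction p with
  | single h => exact G.w_pos _
  | cons h p ih => exact add_pos (G.w_pos _) ih

theorem IsDAG.ne (hG : G.IsDAG) {a b : V} (p : G.Path a b) : a ≠ b := by
  rintro rfl
  exact hG a a ⟨p⟩ ⟨p⟩

theorem IsDAG.spAt_asymm (hG : G.IsDAG) (t : ℝ) (a b : V) (h : (G.spAt t).Adj a b) :
    ¬ (G.spAt t).Adj b a := fun h' => hG a b ⟨h.2.choose⟩ ⟨h'.2.choose⟩

theorem IsDAG.spAt_adj (hG : G.IsDAG) {t : ℝ} {a b : V} (p : G.Path a b) (hp : p.length ≤ t) :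
    (G.spAt t).Adj a b := ⟨hG.ne p, p, hp⟩

/-! ### Comparing paths in a subdivision with paths in the original digraph. -/

namespace Subdivision

variable (S : G.Subdivision)

/-- The first `m` coordinates of the edge `e`, scaled by its weight. -/
def partialWeight (e : S.F) (m : ℕ) : ℝ :=
  (∑ i with (i : Fin (S.d e + 1)).1 < m, S.coord e i) * G.w e.1

theorem partialWeight_zero (e : S.F) : S.partialWeight e 0 = 0 := by
  simp [partialWeight]

theorem coord_pos (e : S.F) (i : Fin (S.d e + 1)) : 0 < S.coord e i := (S.S e).2.2.1 i

theorem partialWeight_succ (e : S.F) (i : Fin (S.d e + 1)) :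
    S.partialWeight e (i + 1) = S.partialWeight e i + S.coord e i * G.w e.1 := by
  have : (Finset.univ.filter fun j : Fin (S.d e + 1) => j.1 < i + 1) =
      insert i (Finset.univ.filter fun j : Fin (S.d e + 1) => j.1 < i) := by
    ext j
    simp [Fin.ext_iff]
    omega
  rw [partialWeight, this, Finset.sum_insert (by simp), partialWeight]
  ring

theorem partialWeight_last (e : S.F) : S.partialWeight e (S.d e + 1) = G.w e.1 := by
  have : (Finset.univ.filter fun j : Fin (S.d e + 1) => j.1 < S.d e + 1) = Finset.univ := by
    ext j
    simp [j.is_le]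
  rw [partialWeight, this, show ∑ i, S.coord e i = 1 from (S.S e).2.2.2, one_mul]

theorem partialWeight_nonneg (e : S.F) (m : ℕ) : 0 ≤ S.partialWeight e m :=
  mul_nonneg (Finset.sum_nonneg fun i _ => (S.coord_pos e i).le) (G.w_pos _).le

theorem partialWeight_le (e : S.F) (m : ℕ) : S.partialWeight e m ≤ G.w e.1 := by
  have : ∑ i with (i : Fin (S.d e + 1)).1 < m, S.coord e i ≤ 1 := by
    rw [← show ∑ i, S.coord e i = 1 from (S.S e).2.2.2]
    exact Finset.sum_le_sum_of_subset_of_nonneg (Finset.filter_subset _ _)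
      fun i _ _ => (S.coord_pos e i).le
  simpa [partialWeight] using mul_le_mul_of_nonneg_right this (G.w_pos e.1).le

/-- The retraction sending each new vertex to the start of its edge. -/
def retract : S.Vert → V
  | .inl v => v
  | .inr x => x.1.1.1.1

/-- The distance of a vertex from its retraction along the subdivided edge. -/
def offset : S.Vert → ℝ
  | .inl _ => 0
  -- The new vertex with index `i` is `v_{e,i+1}`, hence the shift by one.
  | .inr x => S.partialWeight x.1 (x.2 + 1)

theorem offset_nonneg (x : S.Vert) : 0 ≤ S.offset x := by
  rcases x with v | x
  · exact le_rfl
  · exact S.partialWeight_nonneg _ _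

theorem offset_le {δ : ℝ} (h0 : 0 ≤ δ) (hδ : ∀ e : S.F, G.w e.1 ≤ δ) (x : S.Vert) :
    S.offset x ≤ δ := by
  rcases x with v | x
  · exact h0
  · exact (S.partialWeight_le _ _).trans (hδ _)

theorem ends_mem (x : S.EdgeIdx) : ((S.ends x).1, (S.ends x).2) ∈ S.subdivide.E := ⟨x, rfl⟩

theorem subdivide_w_ends (x : S.EdgeIdx) (h : S.ends x ∈ S.subdivide.E) :
    S.subdivide.w ⟨S.ends x, h⟩ = S.weight x :=
  congrArg S.weight ((Equiv.ofInjective S.ends S.ends_injective).symm_apply_apply x)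

/-- The path along the first edges of the subdivision of `e`. -/
theorem exists_path_vert (e : S.F) (i : Fin (S.d e + 1)) :
    ∃ p : S.subdivide.Path (.inl e.1.1.1) (S.vert e i.succ),
      p.length = S.partialWeight e (i + 1) := by
  induction i using Fin.induction with
  | zero =>
    refine ⟨.single (S.ends_mem (.inr ⟨e, 0⟩)), ?_⟩
    rw [partialWeight_succ, Fin.val_zero, partialWeight_zero, zero_add]
    exact S.subdivide_w_ends (.inr ⟨e, 0⟩) _
  | succ i ih =>
    obtain ⟨p, hp⟩ := ih
    refine ⟨p.append (.single (S.ends_mem (.inr ⟨e, i.succ⟩))), ?_⟩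
    rw [Path.length_append, partialWeight_succ, hp]
    exact congrArg _ (S.subdivide_w_ends (.inr ⟨e, i.succ⟩) _)

theorem exists_path_inl {a b : V} (p : G.Path a b) :
    ∃ q : S.subdivide.Path (.inl a) (.inl b), q.length = p.length := by
  have edge : ∀ {a b : V} (h : (a, b) ∈ G.E),
      ∃ q : S.subdivide.Path (.inl a) (.inl b), q.length = G.w ⟨_, h⟩ := by
    intro a b h
    by_cases hF : (⟨_, h⟩ : G.E) ∈ S.F
    · have := S.exists_path_vert ⟨_, hF⟩ (Fin.last _)
      rwa [vert_last, Fin.val_last, partialWeight_last] at this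
    · exact ⟨.single (S.ends_mem (.inl ⟨_, hF⟩)), S.subdivide_w_ends (.inl ⟨_, hF⟩) _⟩
  induction p with
  | single h => exact edge h
  | cons h p ih =>
    obtain ⟨q, hq⟩ := edge h
    obtain ⟨r, hr⟩ := ih
    exact ⟨q.append r, by rw [Path.length_append, hq, hr]; rfl⟩

theorem eq_inl_retract_or_path (x : S.Vert) :
    x = .inl (S.retract x) ∨
      ∃ p : S.subdivide.Path (.inl (S.retract x)) x, p.length = S.offset x := by
  rcases x with v | ⟨e, i⟩
  · exact Or.inl rfl
  · have := S.exists_path_vert e i.castSucc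
    rw [vert_mid] at this
    exact Or.inr this

/-- A move of length `L` in the subdivision, seen after retraction: either the retraction does not
move, or it moves along a path of `G` whose length differs from `L` by the change of offset. -/
def Tracks (x y : S.Vert) (L : ℝ) : Prop :=
  (S.retract x = S.retract y ∧ S.offset y = S.offset x + L) ∨
    ∃ q : G.Path (S.retract x) (S.retract y), q.length = L + S.offset x - S.offset y

variable {S} in
-- The offset acts as a potential: the contributions of the middle vertex cancel.
theorem Tracks.trans {x y z : S.Vert} {L M : ℝ} (h : S.Tracks x y L) (h' : S.Tracks y z M) :
    S.Tracks x z (L + M) := by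
  rcases h with ⟨h1, h2⟩ | ⟨p, hp⟩ <;> rcases h' with ⟨h3, h4⟩ | ⟨q, hq⟩
  · exact Or.inl ⟨h1.trans h3, by rw [h4, h2, add_assoc]⟩
  · right
    rw [h1]
    exact ⟨q, by rw [hq, h2]; ring⟩
  · right
    rw [← h3]
    exact ⟨p, by rw [hp, h4]; ring⟩
  · exact Or.inr ⟨p.append q, by rw [Path.length_append, hp, hq]; ring⟩

/-- Inside a chain the retraction stays at the start of `e` while the offset grows. Only the last
edge of the chain makes it jump, along all of `e`, which spends the accumulated offset. -/
theorem tracks_ends (x : S.EdgeIdx) : S.Tracks (S.ends x).1 (S.ends x).2 (S.weight x) := by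
  rcases x with e | ⟨e, i⟩
  · exact Or.inr ⟨.single e.1.2, by simp [ends, offset, weight, Path.length, retract]⟩
  · change S.Tracks (S.vert e i.castSucc) (S.vert e i.succ) (S.coord e i * G.w e.1)
    have h1 : S.retract (S.vert e i.castSucc) = e.1.1.1 ∧
        S.offset (S.vert e i.castSucc) = S.partialWeight e i := by
      rcases S.vert_begin e i with ⟨rfl, h⟩ | ⟨j, rfl, h⟩ <;> rw [h]
      · exact ⟨rfl, (S.partialWeight_zero e).symm⟩
      · exact ⟨rfl, rfl⟩
    rcases S.vert_finish e i with ⟨rfl, h⟩ | ⟨j, rfl, h⟩ <;> rw [h]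
    · right
      rw [h1.1]
      refine ⟨.single e.1.2, ?_⟩
      have := S.partialWeight_succ e (Fin.last _)
      rw [Fin.val_last, partialWeight_last] at this
      rw [h1.2, Fin.val_last]
      simp only [Path.length, offset, retract]
      linarith
    · exact Or.inl ⟨h1.1, by rw [h1.2]; exact S.partialWeight_succ e j.castSucc⟩

theorem tracks_path {x y : S.Vert} (p : S.subdivide.Path x y) : S.Tracks x y p.length := by
  have edge : ∀ {x y : S.Vert} (h : (x, y) ∈ S.subdivide.E),
      S.Tracks x y (S.subdivide.w ⟨_, h⟩) := by
    intro x y h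
    -- The `id` keeps `h`, on which the weight in the goal depends.
    obtain ⟨e, he⟩ := id h
    obtain ⟨rfl, rfl⟩ := Prod.mk.inj he
    have := S.tracks_ends e
    rwa [← S.subdivide_w_ends e h] at this
  induction p with
  | single h => exact edge h
  | cons h p ih => exact (edge h).trans ih

/-- A closed path would either increase the offset of its base point by its positive length, or
retract to a closed path in `G`. -/
theorem isDAG_subdivide (hG : G.IsDAG) : S.subdivide.IsDAG := by
  rintro x y ⟨p⟩ ⟨q⟩
  rcases S.tracks_path (p.append q) with ⟨-, h⟩ | ⟨r, -⟩
  · have := (p.append q).length_pos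
    linarith
  · exact hG.ne r rfl

/-! ### The interleaving. -/

/-- The inclusion of the old vertices as a morphism of shortest-path filtrations. -/
def inclusion (δ : ℝ≥0) : G.SP ⟶ translate δ ⋙ S.subdivide.SP where
  app t := ⟨Sum.inl, fun a b h => Or.inr ⟨fun h' => h.1 (Sum.inl.inj h'), by
      obtain ⟨p, hp⟩ := h.2
      obtain ⟨q, hq⟩ := S.exists_path_inl p
      exact ⟨q, hq.le.trans (hp.trans (NNReal.coe_le_coe.2 le_self_add))⟩⟩,
    fun a b c _ hac _ h => absurd (Sum.inl.inj h) hac.1⟩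
  naturality _ _ _ := rfl

/-- The retracted path gains at most the offset of its starting point, which is at most `δ`. -/
theorem retract_weak {δ : ℝ≥0} (hδ : ∀ e : S.F, G.w e.1 ≤ δ) (hG : G.IsDAG) {t : ℝ≥0}
    {x y : S.Vert} (h : (S.subdivide.SP.obj t).Adj x y) :
    S.retract x = S.retract y ∨ (G.SP.obj (t + δ)).Adj (S.retract x) (S.retract y) := by
  obtain ⟨p, hp⟩ := h.2
  rcases S.tracks_path p with h | ⟨q, hq⟩
  · exact Or.inl h.1
  · refine Or.inr (hG.spAt_adj q ?_)
    have h1 := S.offset_le δ.2 hδ x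
    have h2 := S.offset_nonneg y
    rw [NNReal.coe_add]
    change S.offset x ≤ (δ : ℝ) at h1
    linarith

/-- The retraction as a morphism of shortest-path filtrations. -/
def retraction {δ : ℝ≥0} (hδ : ∀ e : S.F, G.w e.1 ≤ δ) (hG : G.IsDAG) :
    S.subdivide.SP ⟶ translate δ ⋙ G.SP where
  app t := ⟨S.retract, fun _ _ h => S.retract_weak hδ hG h, fun a b c hab _ hbc h => by
    -- If neither edge collapsed, `h` would give edges in both directions between the images of `a`
    -- and `b`, impossible in a DAG.
    rcases S.retract_weak hδ hG hab with h1 | h1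
    · exact ⟨h1, h1 ▸ h⟩
    · rcases S.retract_weak hδ hG hbc with h2 | h2
      · exact ⟨h.trans h2.symm, h2⟩
      · exact absurd (h ▸ h2) (hG.spAt_asymm _ _ _ h1)⟩
  naturality _ _ _ := rfl

theorem inl_retract_eq_or_adj {δ t : ℝ} (h0 : 0 ≤ δ) (hδ : ∀ e : S.F, G.w e.1 ≤ δ)
    (hG : G.IsDAG) (ht : δ ≤ t) (x : S.Vert) :
    .inl (S.retract x) = x ∨ (S.subdivide.spAt t).Adj (.inl (S.retract x)) x := by
  rcases S.eq_inl_retract_or_path x with h | ⟨p, hp⟩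
  · exact Or.inl h.symm
  · exact Or.inr ((S.isDAG_subdivide hG).spAt_adj p (hp.le.trans ((S.offset_le h0 hδ x).trans ht)))

theorem inl_retract_adj {δ t : ℝ} (h0 : 0 ≤ δ) (hδ : ∀ e : S.F, G.w e.1 ≤ δ) (hG : G.IsDAG)
    {x y : S.Vert} (h : (S.subdivide.spAt t).Adj x y) :
    (S.subdivide.spAt (t + δ)).Adj (.inl (S.retract x)) y := by
  obtain ⟨q, hq⟩ := h.2
  rcases S.eq_inl_retract_or_path x with h | ⟨p, hp⟩
  · rw [← h]
    exact (S.isDAG_subdivide hG).spAt_adj q (hq.trans (le_add_of_nonneg_right h0))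
  · refine (S.isDAG_subdivide hG).spAt_adj (p.append q) ?_
    have := S.offset_le h0 hδ x
    rw [Path.length_append]
    linarith

theorem stepHomotopic_retraction_inclusion {δ : ℝ≥0} (hδ : ∀ e : S.F, G.w e.1 ≤ δ)
    (hG : G.IsDAG) (t : ℝ≥0) :
    TcDgr.StepHomotopic ((S.retraction hδ hG).app t ≫ (S.inclusion δ).app (t + δ))
      (S.subdivide.SP.map (homOfLE (le_self_add.trans le_self_add : t ≤ t + δ + δ))) := by
  have h1 : (δ : ℝ) ≤ (t + δ + δ : ℝ≥0) := NNReal.coe_le_coe.2 le_add_self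
  have h2 : ((t + δ : ℝ≥0) : ℝ) ≤ (t + δ + δ : ℝ≥0) := NNReal.coe_le_coe.2 le_self_add
  refine ⟨S.inl_retract_eq_or_adj δ.2 hδ hG h1, fun x y hxy => Or.inr ?_⟩
  have := S.inl_retract_adj δ.2 hδ hG hxy
  exact ⟨this.1, this.2.imp fun _ hp => hp.trans h2⟩

/-- The inclusion and the retraction interleave the persistent homologies. -/
def interleaving (k : Type v) [Field k] {δ : ℝ≥0} (hδ : ∀ e : S.F, G.w e.1 ≤ δ)
    (hG : G.IsDAG) :
    Interleaving (G.SP ⋙ TcDgr.homology k) (S.subdivide.SP ⋙ TcDgr.homology k) δ where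
  f := Functor.whiskerRight (S.inclusion δ) (TcDgr.homology k)
  g := Functor.whiskerRight (S.retraction hδ hG) (TcDgr.homology k)
  -- Retracting an old vertex returns it, so this identity already holds for digraph maps.
  fg _ := ((TcDgr.homology k).map_comp _ _).symm.trans (congrArg (TcDgr.homology k).map rfl)
  gf t := ((TcDgr.homology k).map_comp _ _).symm.trans
    ((S.stepHomotopic_retraction_inclusion hδ hG t).homology_map_eq
      ((S.isDAG_subdivide hG).spAt_asymm _) k)

end Subdivision

end WeightedDigraph

end DirectedFlag

end

theorem mainTheorem4 {k : Type v} [Field k] {V : Type u}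
    (G : DirectedFlag.WeightedDigraph V) (hG : G.IsDAG) (S : G.Subdivision) :
    DirectedFlag.interleavingDist
        (G.SP ⋙ DirectedFlag.TcDgr.homology k)
        (S.subdivide.SP ⋙ DirectedFlag.TcDgr.homology k)
      ≤ ⨆ e : S.F, ENNReal.ofReal (G.w e) := by
  -- A finite supremum serves itself as `δ`, so no limiting argument is needed; for empty `F` this
  -- gives `δ = 0`.
  rcases eq_or_ne (⨆ e : S.F, ENNReal.ofReal (G.w e)) ⊤ with h | h
  · exact h ▸ le_top
  · obtain ⟨δ, hδ⟩ := ENNReal.canLift.prf _ h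
    rw [← hδ]
    refine iInf₂_le δ ⟨S.interleaving k (fun e => ?_) hG⟩
    have he : ENNReal.ofReal (G.w e) ≤ δ := hδ ▸ le_iSup (fun e : S.F => ENNReal.ofReal (G.w e)) e
    simpa using ENNReal.ofReal_le_iff_le_toReal ENNReal.coe_ne_top |>.1 he
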